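/- **Setting.** An architecture with $L\ge 1$ layers consists of filter sizes $\mathbf k=(k_1,\dots,k_L)$ and strides $\mathbf s=(s_1,\dots,s_L)$, all positive integers. Put $$k:=k_1+\sum_{\ell=2}^{L}(k_\ell-1)\prod_{i=1}^{\ell-1}s_i ,\qquad s:=s_1\cdots s_L .$$ For a filter $w\in\mathbb C^{n}$ and a stride $t$, the convolution $\alpha_{w,t}:\mathbb C^{d}\to\mathbb C^{d'}$, where $d=t(d'-1)+n$ and $d'\ge1$, is the linear map $x\mapsto\bigl[\sum_{j=0}^{n-1}w[j]\,x[it+j]\bigr]_{0\le i<d'}$. The complex neurovariety $\mathcal M^{\mathbb C}_{\mathbf k,\mathbf s}\subseteq\mathbb C^{k}$ is the set of all $w\in\mathbb C^k$ such that $\alpha_{w,s}=\alpha_{w_L,s_L}\circ\cdots\circ\alpha_{w_1,s_1}$ for some filters $w_\ell\in\mathbb C^{k_\ell}$; here the output dimension $d_L\ge1$ may be any fixed positive integer, and the statement below holds for each choice of it. **Resultant-minor ideals.** Let $K=k_1+s_1(k_2-1)$ and let $Q=\sum_{j=0}^{K-1}w_jx^{K-1-j}y^j$ be the generic binary form over $\mathbb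 C[w_0,\dots,w_{K-1}]$. Write $$Q=\sum_{i=1}^{s_1}x^{i-1}\,y^{(K-i)\bmod s_1}\,q_i(x^{s_1},y^{s_1})$$ with binary forms $q_i(x,y)$ of degree $n_i=\lfloor (K-i)/s_1\rfloor$ ($q_i=0$ if $n_i<0$). Let $n^*=\lfloor (K-1)/s_1\rfloor$ and let $q_1,\dots,q_r$, $r=((K-1)\bmod s_1)+1$, be those of the $q_i$ that have degree $n^*$. For a list of binary forms, $R_l$ denotes the matrix with $l+1$ columns that has, for each form $q$ of degree $n$ in the list, $\max(0,l-n+1)$ rows, namely the successive shifts of the coefficient vector of $q$ (the coefficient vectors of $x^{l-n}q,\,x^{l-n-1}y\,q,\dots,y^{l-n}q$). Let $\mathfrak I_1$ be the ideal generated by all minors of size $2n^*-2k_2+3$ of the matrix $R_{2n^*-k_2}$ of $q_1,\dots,q_{s_1}$, let $\mathfrak I_2$ be the ideal generated by all minors of size $2n^*-2k_2+4$ of the matrix $R_{2n^*-k_2+1}$ of $q_1,\dots,q_r$, and let $\mathfrak I=\mathfrak I_1+\mathfrak I_2$ (if a matrix has no minors of the given size, the corresponding ideal is $0$). **Algorithm.**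 Define recursively an ideal $\mathrm{vanish}(L,\mathbf k,\mathbf s)$ of $\mathbb C[w_0,\dots,w_{k-1}]$: * if $L=1$, it is the zero ideal; * if $L=2$, it is $\sqrt{\mathfrak I}$, with $\mathfrak I$ the ideal above for $k_1,k_2,s_1$; * if $L>2$, it is $\sqrt{\mathfrak a+\mathfrak b}$, where $\mathfrak a=\mathrm{vanish}(L-1,\mathbf k',\mathbf s')$ with $\mathbf k'=(k_1+s_1(k_2-1),k_3,\dots,k_L)$, $\mathbf s'=(s_1s_2,s_3,\dots,s_L)$, and $\mathfrak b=\mathrm{vanish}\bigl(2,(k_1,\tfrac{k-k_1}{s_1}+1),(s_1,1)\bigr)$. (The end-to-end filter size of both architectures in the last case is again $k$, so $\mathfrak a$ and $\mathfrak b$ lie in the same polynomial ring.) **Theorem.** For every $L\ge1$ and all $\mathbf k,\mathbf s$ with positive entries, the algorithm computes the vanishing ideal of the complex neurovariety: $$\mathrm{vanish}(L,\mathbf k,\mathbf s)=\{f\in\mathbb C[w_0,\dots,w_{k-1}]:\ f(w)=0\ \text{ for all } w\in\mathcal M^{\mathbb C}_{\mathbf k,\mathbf s}\}.$$ -/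

import Mathlib

open scoped BigOperators

/-! An architecture `(𝐤, 𝐬)` with `L` layers is the list `[(k₁, s₁), …, (k_L, s_L)]` of its
filter sizes and strides, first layer first. -/

/-- The convolution `α_{w,s} : ℂ^{d} → ℂ^{d'}` with filter `w ∈ ℂ^k` and stride `s`,
`x ↦ [∑_j w[j] x[i s + j]]_i`, where `d' = (d - k) / s + 1`, that is `d = s (d' - 1) + k`. -/
def convolution {k d d' : ℕ} (w : Fin k → ℂ) (s : ℕ) (h : d = s * (d' - 1) + k) :
    (Fin d → ℂ) →ₗ[ℂ] (Fin d' → ℂ) where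
  toFun x i := ∑ j : Fin k, w j * x ⟨i * s + j, by
    have hi : (i : ℕ) ≤ d' - 1 := by have := i.2; omega
    have hm : (i : ℕ) * s ≤ s * (d' - 1) := by
      rw [mul_comm]; exact Nat.mul_le_mul_left s hi
    have := j.2
    omega⟩
  map_add' x y := by
    funext i
    simp [mul_add, Finset.sum_add_distrib]
  map_smul' c x := by
    funext i
    simp [Finset.mul_sum, mul_left_comm]

/-- `φ : ℂ^{d₀} → ℂ^{d}` can be written as a composition `α_{w_L,s_L} ∘ ⋯ ∘ α_{w_1,s_1}` of
convolutions with complex filters `w_ℓ ∈ ℂ^{k_ℓ}` and strides `s_ℓ`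
(with intermediate spaces of positive dimension). -/
def IsNetworkMap : List (ℕ × ℕ) → (d₀ d : ℕ) → ((Fin d₀ → ℂ) →ₗ[ℂ] (Fin d → ℂ)) → Prop
  | [], _, _, _ => False
  | [(k, s)], d₀, d, φ =>
      ∃ (h : d₀ = s * (d - 1) + k) (w : Fin k → ℂ), φ = convolution w s h
  | (k, s) :: layer :: rest, d₀, d, φ =>
      ∃ (d₁ : ℕ) (_ : 0 < d₁) (h : d₀ = s * (d₁ - 1) + k) (w : Fin k → ℂ)
        (ψ : (Fin d₁ → ℂ) →ₗ[ℂ] (Fin d → ℂ)),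
        IsNetworkMap (layer :: rest) d₁ d ψ ∧ φ = ψ ∘ₗ convolution w s h

/-- The size `k = k₁ + ∑_{ℓ ≥ 2} (k_ℓ - 1) s₁ ⋯ s_{ℓ-1}` of the end-to-end filter. -/
def filterSize : List (ℕ × ℕ) → ℕ
  | [] => 1
  | (k, s) :: rest => k + s * (filterSize rest - 1)

/-- The stride `s = s₁ ⋯ s_L` of the end-to-end convolution. -/
def totalStride (arch : List (ℕ × ℕ)) : ℕ := (arch.map Prod.snd).prod

/-- The complex neurovariety of an architecture: the set of all end-to-end filters `w ∈ ℂ^k` whose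
convolution `α_{w,s}` is a composition of convolutions as prescribed by the architecture.
Here `d` is the output dimension of the network; its input dimension is then `s (d - 1) + k`. -/
def complexNeurovariety (arch : List (ℕ × ℕ)) (d : ℕ) : Set (Fin (filterSize arch) → ℂ) :=
  {w | IsNetworkMap arch (totalStride arch * (d - 1) + filterSize arch) d
    (convolution w (totalStride arch) rfl)}

section Resultants

variable {R : Type*} [CommRing R]

/-- The filter `w` of size `K` stands for the binary form `Q = ∑_j w_j x^{K-1-j} y^j`. Its
`s`-decomposition is `Q = ∑_{i < s} x^i y^{(K-1-i) mod s} q_i(x^s, y^s)` with binary forms `q_i` of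
degree `⌊(K-1-i)/s⌋` (the index `i` starts at `0`). This is the number `⌊(K-1-i)/s⌋ + 1` of
coefficients of `q_i`, which is `0` if `i ≥ K`. -/
def sDecompLength (K s i : ℕ) : ℕ := (K + s - 1 - i) / s

/-- The coefficient of `x^{n-t} y^t`, `n = ⌊(K-1-i)/s⌋`, in the binary form `q_i` of the
`s`-decomposition; it is `0` for `t > n`. -/
def sDecompCoeff {K : ℕ} (w : Fin K → R) (s i t : ℕ) : R :=
  if h : (K + s - 1 - i) % s + s * t < K then w ⟨(K + s - 1 - i) % s + s * t, h⟩ else 0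

/-- The numbers `sDecompCoeff` are the coefficients of the `s`-decomposition of
`Q = ∑_j w_j x^{K-1-j} y^j`. -/
theorem sDecomp_eq {K s : ℕ} (hs : 0 < s) (w : Fin K → R) (x y : R) :
    ∑ j : Fin K, w j * x ^ (K - 1 - j) * y ^ (j : ℕ) =
      ∑ i ∈ Finset.range s, x ^ i * y ^ ((K + s - 1 - i) % s) *
        ∑ t ∈ Finset.range (sDecompLength K s i),
          sDecompCoeff w s i t * (x ^ s) ^ (sDecompLength K s i - 1 - t) * (y ^ s) ^ t := by
  simp_rw [Finset.mul_sum]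
  rw [Finset.sum_sigma']
  have key : ∀ j, j < K → (K + s - 1 - (K - 1 - j) % s) % s = j % s ∧
      sDecompLength K s ((K - 1 - j) % s) = j / s + (K - 1 - j) / s + 1 := by
    intro j hj
    have h1 := Nat.div_add_mod j s
    have h2 := Nat.div_add_mod (K - 1 - j) s
    have h3 := Nat.mod_lt j hs
    have h4 := Nat.mod_lt (K - 1 - j) hs
    have h5 : K + s - 1 - (K - 1 - j) % s = j % s + s * (j / s + (K - 1 - j) / s + 1) := by
      rw [mul_add, mul_add, mul_one]
      generalize (K - 1 - j) % s = a at *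
      generalize s * ((K - 1 - j) / s) = b at *
      generalize s * (j / s) = c at *
      generalize j % s = e at *
      omega
    unfold sDecompLength
    rw [h5]
    clear h1 h2 h5
    constructor
    · rw [Nat.add_mul_mod_self_left, Nat.mod_mod]
    · rw [Nat.add_mul_div_left _ _ hs, Nat.div_eq_of_lt h3, zero_add]
  have back : ∀ i t, i < s → t < sDecompLength K s i →
      (K + s - 1 - i) % s + s * t + i + s * (sDecompLength K s i - 1 - t) + 1 = K := by
    intro i t hi ht
    unfold sDecompLength at *
    have h1 := Nat.div_add_mod (K + s - 1 - i) s
    obtain ⟨u, hu⟩ := Nat.exists_eq_add_of_lt ht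
    rw [hu] at h1 ⊢
    have : t + u + 1 - 1 - t = u := by omega
    rw [this]
    simp only [mul_add, mul_one] at h1
    omega
  refine Finset.sum_bij' (fun j _ => ⟨(K - 1 - j) % s, (j : ℕ) / s⟩)
    (fun p hp => ⟨(K + s - 1 - p.1) % s + s * p.2, by
      simp only [Finset.mem_sigma, Finset.mem_range] at hp
      have := back _ _ hp.1 hp.2
      omega⟩) ?_ ?_ ?_ ?_ ?_
  · intro j _
    simp only [Finset.mem_sigma, Finset.mem_range]
    refine ⟨Nat.mod_lt _ hs, ?_⟩
    rw [(key j j.2).2]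
    exact Nat.lt_succ_of_le (Nat.le_add_right _ _)
  · intro p _; exact Finset.mem_univ _
  · intro j _
    ext
    simp only
    rw [(key j j.2).1]
    have := Nat.div_add_mod (j : ℕ) s
    omega
  · rintro ⟨i, t⟩ hp
    simp only [Finset.mem_sigma, Finset.mem_range] at hp
    have hb := back _ _ hp.1 hp.2
    have e1 : (K - 1 - ((K + s - 1 - i) % s + s * t)) % s = i := by
      have : K - 1 - ((K + s - 1 - i) % s + s * t) = i + s * (sDecompLength K s i - 1 - t) := by omega
      rw [this, Nat.add_mul_mod_self_left, Nat.mod_eq_of_lt hp.1]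
    have e2 : ((K + s - 1 - i) % s + s * t) / s = t := by
      rw [Nat.add_mul_div_left _ _ hs, Nat.div_eq_of_lt (Nat.mod_lt _ hs), zero_add]
    simp only [e1, e2]
  · intro j _
    obtain ⟨k1, k2⟩ := key j j.2
    have h1 := Nat.div_add_mod (j : ℕ) s
    have h2 := Nat.div_add_mod (K - 1 - j) s
    have hc : sDecompCoeff w s ((K - 1 - j) % s) (j / s) = w j := by
      unfold sDecompCoeff
      rw [k1]
      have : (j : ℕ) % s + s * (j / s) = j := by omega
      simp [this]
    simp only [hc, k1, k2]
    have e : (j : ℕ) / s + (K - 1 - j) / s + 1 - 1 - j / s = (K - 1 - j) / s := by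
      generalize (K - 1 - (j : ℕ)) / s = a
      generalize (j : ℕ) / s = b
      omega
    rw [e]
    conv_lhs => rw [← h2]
    rw [pow_add, pow_mul]
    have : y ^ (j : ℕ) = (y ^ s) ^ ((j : ℕ) / s) * y ^ ((j : ℕ) % s) := by
      rw [← pow_mul, ← pow_add, h1]
    rw [this]; ring

/-- The resultant matrix `R_l`, with `c = l + 1` columns, of binary forms `q_1, …, q_a`, where `q_i`
has `N i` coefficients `A i 0, …, A i (N i - 1)` (so that its degree is `n_i = N i - 1`): there are
`max (0, l - n_i + 1)` rows associated with `q_i`, the shifts of its coefficient vector. -/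
def resultantMatrix {a : ℕ} (N : Fin a → ℕ) (A : Fin a → ℕ → R) (c : ℕ) :
    Matrix (Σ i : Fin a, Fin (c + 1 - N i)) (Fin c) R :=
  Matrix.of fun p b =>
    if (p.2 : ℕ) ≤ b ∧ (b : ℕ) - p.2 < N p.1 then A p.1 (b - p.2) else 0

/-- The ideal generated by all minors of size `p` of a matrix. -/
def minorIdeal {m n : Type*} (M : Matrix m n R) (p : ℕ) : Ideal R :=
  Ideal.span {x | ∃ (f : Fin p ↪ m) (g : Fin p ↪ n), x = (M.submatrix f g).det}

end Resultants

/-- The ideal `𝔍₁` of all minors of size `2 n* - 2 k₂ + 3` of the resultant matrix `R_l`,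
`l = 2 n* - k₂`, of the forms `q_1, …, q_s` of the `s`-decomposition of the generic binary form with
`K = k₁ + s (k₂ - 1)` coefficients, where `n* = ⌊(K-1)/s⌋`. -/
noncomputable def minorIdealOne (K k₂ s : ℕ) : Ideal (MvPolynomial (Fin K) ℂ) :=
  minorIdeal
    (resultantMatrix (a := s) (fun i => sDecompLength K s i)
      (fun i => sDecompCoeff (MvPolynomial.X (R := ℂ) (σ := Fin K)) s i)
      (2 * ((K - 1) / s) + 1 - k₂))
    (2 * ((K - 1) / s) + 3 - 2 * k₂)

/-- The ideal `𝔍₂` of all minors of size `2 n* - 2 k₂ + 4` of the resultant matrix `R_l`,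
`l = 2 n* - k₂ + 1`, of those forms `q_1, …, q_r`, `r = (K-1) mod s + 1`, of the `s`-decomposition
that have the maximal degree `n* = ⌊(K-1)/s⌋`. -/
noncomputable def minorIdealTwo (K k₂ s : ℕ) : Ideal (MvPolynomial (Fin K) ℂ) :=
  minorIdeal
    (resultantMatrix (a := (K - 1) % s + 1) (fun i => sDecompLength K s i)
      (fun i => sDecompCoeff (MvPolynomial.X (R := ℂ) (σ := Fin K)) s i)
      (2 * ((K - 1) / s) + 2 - k₂))
    (2 * ((K - 1) / s) + 4 - 2 * k₂)

/-- The recursive algorithm. `K` is the size of the end-to-end filter, which the recursive calls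
leave unchanged; the ideals live in the polynomial ring `ℂ[w_0, …, w_{K-1}]`. -/
noncomputable def vanish (K : ℕ) : List (ℕ × ℕ) → Ideal (MvPolynomial (Fin K) ℂ)
  | [] => ⊥
  | [_] => ⊥
  | [(_, s₁), (k₂, _)] => (minorIdealOne K k₂ s₁ + minorIdealTwo K k₂ s₁).radical
  | (k₁, s₁) :: (k₂, s₂) :: layer :: rest =>
      (vanish K ((k₁ + s₁ * (k₂ - 1), s₁ * s₂) :: layer :: rest)
        + vanish K [(k₁, s₁), ((K - k₁) / s₁ + 1, 1)]).radical
  termination_by arch => arch.length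

/-! Encode a filter `w` as `W = ∑ w_j X^j`. Composing convolutions multiplies polynomials after
substituting powers of `X`, so the neurovariety is the set of products `A₁(X) A₂(X^{s₁})
A₃(X^{s₁s₂}) ⋯` with degree bounds, whatever the output dimension (`mem_complexNeurovariety_iff`).
Since `vanish` is radical, the Nullstellensatz reduces the theorem to showing that its zero locus is
this set.

Two layers: write `W = ∑ X^{e_i} q_i(X^s)`. Then `W = A(X) B(X^s)` means that the `q_i`, as binary
forms, share a factor of degree `m = k₂ - 1` (`exists_eq_mul_expand_iff`). Such a factor bounds the
ranks of the resultant matrices. If instead the gcd has degree `e < m`, generic combinations of the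
cofactors are coprime, and a Sylvester-type independence argument makes one of the ranks too large
(`hasCommonFactor_iff_finrank_lt`). Two matrices are needed because the `q_i` have two possible
degrees.

More layers: a polynomial factors along the whole architecture if and only if it factors after
merging the first two layers and also after merging all layers but the first
(`mem_filterProducts_cons_cons_iff`). The point is that `U(X) T(X^s) = A(X) D(X^s)` forces a factor
in `X^s` to split off from `U`, by comparing the parts of both sides. -/

open Polynomial in
/-- A product of a polynomial of degree less than `a` and one of degree at most `b` has degree less
than `a + b`. -/
theorem mul_mem_degreeLT {F : Type*} [Field F] {p q : F[X]} {a b c : ℕ} (hp : p ∈ degreeLT F a)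
    (hq : q.natDegree ≤ b) (hc : a + b ≤ c) : q * p ∈ degreeLT F c := by
  by_cases h0 : p = 0
  · simp [h0]
  by_cases h1 : q = 0
  · simp [h1]
  rw [mem_degreeLT, degree_eq_natDegree h0, Nat.cast_lt] at hp
  rw [mem_degreeLT, degree_eq_natDegree (mul_ne_zero h1 h0), Nat.cast_lt, natDegree_mul h1 h0]
  omega

open Polynomial in
theorem natDegree_lt_of_mem_degreeLT {F : Type*} [Field F] {p : F[X]} {a : ℕ}
    (hp : p ∈ degreeLT F a) (h0 : p ≠ 0) : p.natDegree < a := by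
  rwa [mem_degreeLT, degree_eq_natDegree h0, Nat.cast_lt] at hp

open Polynomial in
theorem mem_degreeLT_of_natDegree_lt {F : Type*} [Field F] {p : F[X]} {a : ℕ}
    (hp : p ≠ 0 → p.natDegree < a) : p ∈ degreeLT F a := by
  by_cases h0 : p = 0
  · simp [h0]
  · rw [mem_degreeLT, degree_eq_natDegree h0, Nat.cast_lt]
    exact hp h0

/-! ### Common factors and coprime combinations of binary forms. -/

section CommonFactor

open Polynomial

variable {F : Type*} [Field F] {ι : Type*}

/-- The binary forms given by the dehomogenized polynomials `q i` with `N i` coefficients have a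
common factor of degree `m`. -/
def HasCommonFactor (N : ι → ℕ) (q : ι → F[X]) (m : ℕ) : Prop :=
  ∃ B : F[X], B ≠ 0 ∧ B.natDegree ≤ m ∧ ∀ i, ∃ a ∈ degreeLT F (N i - m), q i = B * a

/-- The binary forms given by the polynomials `v i` with `N i` coefficients have no common zero on
the projective line over `F`. -/
def NoCommonZero (N : ι → ℕ) (v : ι → F[X]) : Prop :=
  (∀ z, ∃ i, (v i).eval z ≠ 0) ∧ ∃ i, (v i).coeff (N i - 1) ≠ 0

theorem hasCommonFactor_zero {N : ι → ℕ} {q : ι → F[X]} (hq : ∀ i, q i ∈ degreeLT F (N i)) :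
    HasCommonFactor N q 0 :=
  ⟨1, one_ne_zero, by simp, fun i => ⟨q i, by simpa using hq i, by simp⟩⟩

theorem hasCommonFactor_succ_or {N : ι → ℕ} {q : ι → F[X]} {m : ℕ} (h : HasCommonFactor N q m) :
    HasCommonFactor N q (m + 1) ∨ ∃ B : F[X], B ≠ 0 ∧ B.natDegree ≤ m ∧ ∃ v : ι → F[X],
      (∀ i, v i ∈ degreeLT F (N i - m)) ∧ (∀ i, q i = B * v i) ∧
      NoCommonZero (fun i => N i - m) v := by
  obtain ⟨B, hB, hBm, h⟩ := h
  choose v hv hqv using h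
  by_cases hz : ∃ z, ∀ i, (v i).eval z = 0
  · left
    obtain ⟨z, hz⟩ := hz
    refine ⟨B * (X - C z), mul_ne_zero hB (X_sub_C_ne_zero z), ?_, fun i => ?_⟩
    · rw [natDegree_mul hB (X_sub_C_ne_zero z), natDegree_X_sub_C]; omega
    · obtain ⟨u, hu⟩ := dvd_iff_isRoot.2 (hz i)
      refine ⟨u, mem_degreeLT_of_natDegree_lt fun hu0 => ?_, by rw [hqv, hu, mul_assoc]⟩
      have := natDegree_lt_of_mem_degreeLT (hv i)
        (by rw [hu]; exact mul_ne_zero (X_sub_C_ne_zero z) hu0)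
      rw [hu, natDegree_mul (X_sub_C_ne_zero z) hu0, natDegree_X_sub_C] at this
      omega
  by_cases ht : ∃ i, (v i).coeff (N i - m - 1) ≠ 0
  · right
    push Not at hz
    exact ⟨B, hB, hBm, v, hv, hqv, hz, ht⟩
  · left
    push Not at ht
    -- The common zero is at infinity: `B` stays the same, and only the degree bounds of the
    -- cofactors drop.
    refine ⟨B, hB, by omega, fun i => ⟨v i, mem_degreeLT_of_natDegree_lt fun h0 => ?_, hqv i⟩⟩
    have h1 := natDegree_lt_of_mem_degreeLT (hv i) h0
    have h2 : (v i).natDegree ≠ N i - m - 1 := fun h => by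
      have := ht i
      rw [← h, coeff_natDegree, leadingCoeff_eq_zero] at this
      exact h0 this
    omega

/-- Either a family of binary forms has a common factor of degree `m`, or dividing it by a greatest
common divisor, of degree `e < m`, gives a family without common zeros. -/
theorem hasCommonFactor_or {N : ι → ℕ} {q : ι → F[X]} (hq : ∀ i, q i ∈ degreeLT F (N i)) (m : ℕ) :
    HasCommonFactor N q m ∨ ∃ e < m, ∃ B : F[X], B ≠ 0 ∧ B.natDegree ≤ e ∧ ∃ v : ι → F[X],
      (∀ i, v i ∈ degreeLT F (N i - e)) ∧ (∀ i, q i = B * v i) ∧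
      NoCommonZero (fun i => N i - e) v := by
  induction m with
  | zero => exact Or.inl (hasCommonFactor_zero hq)
  | succ m ih =>
    obtain h | ⟨e, he, h⟩ := ih
    · obtain h | h := hasCommonFactor_succ_or h
      · exact Or.inl h
      · exact Or.inr ⟨m, by omega, h⟩
    · exact Or.inr ⟨e, by omega, h⟩

/-- Coprimality gives `g ∣ a`, while `a` has smaller degree than `g`. This is the injectivity of the
Sylvester map. -/
theorem eq_zero_of_isCoprime_of_add_eq_zero {f g a b : F[X]} {n : ℕ} (h : IsCoprime f g)
    (hg : g.coeff n ≠ 0) (ha : a ∈ degreeLT F n) (hab : a * f + b * g = 0) : a = 0 ∧ b = 0 := by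
  have hg0 : g ≠ 0 := by rintro rfl; simp at hg
  have hdvd : g ∣ a := h.symm.dvd_of_dvd_mul_right ⟨-b, by linear_combination hab⟩
  have ha0 : a = 0 := by
    by_contra h0
    have h1 := natDegree_le_of_dvd hdvd h0
    have h2 := le_natDegree_of_ne_zero hg
    have h3 := natDegree_lt_of_mem_degreeLT ha h0
    omega
  subst ha0
  simpa [hg0] using hab

variable [IsAlgClosed F]

theorem isCoprime_of_eval_ne_zero {f g : F[X]} (h : ∀ z, f.eval z = 0 → g.eval z ≠ 0) :
    IsCoprime f g := by
  rw [Polynomial.isCoprime_iff_aeval_ne_zero_of_isAlgClosed F F]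
  intro z
  by_cases hz : f.eval z = 0
  · right; simpa using h z hz
  · left; simpa using hz

/-- A generic member of a space of polynomials. -/
theorem exists_mem_generic (V : Submodule F F[X]) (S : Finset F) (T : Finset ℕ) :
    ∃ f ∈ V, (∀ z ∈ S, (∃ v ∈ V, v.eval z ≠ 0) → f.eval z ≠ 0) ∧
      ∀ n ∈ T, (∃ v ∈ V, v.coeff n ≠ 0) → f.coeff n ≠ 0 := by
  classical
  have : Infinite F := IsAlgClosed.instInfinite
  have : Finite {z : F // z ∈ S ∧ ∃ v ∈ V, v.eval z ≠ 0} :=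
    (S.finite_toSet.subset fun z hz => hz.1 : {z | z ∈ S ∧ ∃ v ∈ V, v.eval z ≠ 0}.Finite)
  have : Finite {n : ℕ // n ∈ T ∧ ∃ v ∈ V, v.coeff n ≠ 0} :=
    (T.finite_toSet.subset fun z hz => hz.1 : {n | n ∈ T ∧ ∃ v ∈ V, v.coeff n ≠ 0}.Finite)
  -- Over an infinite field, finitely many functionals that are nonzero on `V` are all nonzero at a
  -- single member.
  obtain ⟨f, hf, h⟩ := Module.Dual.exists_forall_mem_ne_zero_of_forall_exists V
    (ι := {z : F // z ∈ S ∧ ∃ v ∈ V, v.eval z ≠ 0} ⊕ {n : ℕ // n ∈ T ∧ ∃ v ∈ V, v.coeff n ≠ 0})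
    (Sum.elim (fun z => leval z.1) (fun n => lcoeff F n.1)) (by
      rintro (⟨z, -, hz⟩ | ⟨n, -, hn⟩)
      · simpa using hz
      · simpa using hn)
  refine ⟨f, hf, fun z hz hv => ?_, fun n hn hv => ?_⟩
  · simpa using h (Sum.inl ⟨z, hz, hv⟩)
  · simpa using h (Sum.inr ⟨n, hn, hv⟩)

theorem exists_mem_generic_ne_zero {V : Submodule F F[X]} (hV : V ≠ ⊥) (S : Finset F) (n : ℕ) :
    ∃ f ∈ V, f ≠ 0 ∧ (∀ z ∈ S, (∃ v ∈ V, v.eval z ≠ 0) → f.eval z ≠ 0) ∧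
      ((∃ v ∈ V, v.coeff n ≠ 0) → f.coeff n ≠ 0) := by
  obtain ⟨v, hv, hv0⟩ := V.ne_bot_iff.1 hV
  -- The extra index `v.natDegree` forces `f ≠ 0`.
  obtain ⟨f, hf, h1, h2⟩ := exists_mem_generic V S {n, v.natDegree}
  refine ⟨f, hf, ?_, h1, h2 n (by simp)⟩
  rintro rfl
  exact h2 v.natDegree (by simp) ⟨v, hv, by simpa using hv0⟩ (by simp)

/-- Two coprime members of a space of forms of degree `n` without common zeros. -/
theorem exists_mem_isCoprime {V : Submodule F F[X]} {n : ℕ} (hz : ∀ z, ∃ v ∈ V, v.eval z ≠ 0)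
    (ht : ∃ v ∈ V, v.coeff n ≠ 0) : ∃ f ∈ V, ∃ g ∈ V, IsCoprime f g ∧ g.coeff n ≠ 0 := by
  classical
  obtain ⟨f, hf, hf0⟩ := hz 0
  have hf0 : f ≠ 0 := by rintro rfl; simp at hf0
  obtain ⟨g, hg, h1, h2⟩ := exists_mem_generic V f.roots.toFinset {n}
  refine ⟨f, hf, g, hg, isCoprime_of_eval_ne_zero fun z hfz => ?_, h2 n (by simp) ht⟩
  exact h1 z (by simpa [hf0] using hfz) (hz z)

/-- Coprime members of two nonzero spaces of forms, of degrees `n` and `n'`, without a zero common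
to both spaces. -/
theorem exists_mem_mem_isCoprime {V W : Submodule F F[X]} {n n' : ℕ} (hV : V ≠ ⊥) (hW : W ≠ ⊥)
    (hz : ∀ z, (∃ v ∈ V, v.eval z ≠ 0) ∨ ∃ v ∈ W, v.eval z ≠ 0)
    (ht : (∃ v ∈ V, v.coeff n ≠ 0) ∨ ∃ v ∈ W, v.coeff n' ≠ 0) :
    ∃ f ∈ V, ∃ g ∈ W, IsCoprime f g ∧ (f.coeff n ≠ 0 ∨ g.coeff n' ≠ 0) := by
  classical
  -- Zeros common to all of `W` are roots of this single `h`, so `f` must be generic at finitely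
  -- many points only.
  obtain ⟨h, hh, hh0⟩ := W.ne_bot_iff.1 hW
  obtain ⟨f, hf, hf0, h1, h2⟩ := exists_mem_generic_ne_zero hV h.roots.toFinset n
  obtain ⟨g, hg, -, h3, h4⟩ := exists_mem_generic_ne_zero hW f.roots.toFinset n'
  refine ⟨f, hf, g, hg, isCoprime_of_eval_ne_zero fun z hfz => ?_, ht.imp h2 h4⟩
  refine h3 z (by simpa [hf0] using hfz) ?_
  by_contra hc
  refine h1 z ?_ ((hz z).resolve_right hc) hfz
  push Not at hc
  simpa [hh0] using hc h hh

end CommonFactor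

/-! ### Rank and minors over a field. -/

theorem Matrix.exists_linearIndependent_rows {F m n : Type*} [Field F] [Fintype m] [Fintype n]
    (M : Matrix m n F) {p : ℕ} (hp : p ≤ M.rank) :
    ∃ f : Fin p ↪ m, LinearIndependent F (M.submatrix f id).row := by
  rw [M.rank_eq_finrank_span_row] at hp
  obtain ⟨f, hf, -, hli⟩ := Submodule.exists_fun_fin_finrank_span_eq F (Set.range M.row)
  choose r hr using hf
  have hli' : LinearIndependent F fun j => M.row (r j) := by simpa only [hr] using hli
  have hli := hli'.comp (Fin.castLE hp) (Fin.castLE_injective hp)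
  refine ⟨⟨fun j => r (Fin.castLE hp j), fun i j hij => hli.injective ?_⟩, hli⟩
  simp only [Function.comp] at hij ⊢
  rw [hij]

theorem Matrix.forall_minor_eq_zero_iff_rank_lt {F m n : Type*} [Field F] [Fintype m] [Fintype n]
    (M : Matrix m n F) (p : ℕ) :
    (∀ (f : Fin p ↪ m) (g : Fin p ↪ n), (M.submatrix f g).det = 0) ↔ M.rank < p := by
  constructor
  · intro h
    by_contra! hp
    obtain ⟨f, hf⟩ := M.exists_linearIndependent_rows hp
    have h1 : (M.submatrix f id).transpose.rank = p := by
      rw [Matrix.rank_transpose, hf.rank_matrix, Fintype.card_fin]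
    obtain ⟨g, hg⟩ := Matrix.exists_linearIndependent_rows _ h1.ge
    have h2 : ((M.submatrix f id).transpose.submatrix g id) = (M.submatrix f g).transpose := rfl
    rw [h2, Matrix.linearIndependent_rows_iff_isUnit, Matrix.isUnit_iff_isUnit_det,
      Matrix.det_transpose, h f g] at hg
    exact not_isUnit_zero hg
  · intro h f g
    by_contra hdet
    have h1 := Matrix.rank_of_isUnit (M.submatrix f g)
      ((Matrix.isUnit_iff_isUnit_det _).2 (isUnit_iff_ne_zero.2 hdet))
    have h2 := M.rank_submatrix_le f g
    rw [h1, Fintype.card_fin] at h2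
    omega

/-! ### Row spaces of resultant matrices as spaces of polynomials. -/

section Shifts

open Polynomial Module

variable {F : Type*} [Field F]

/-- The polynomial `∑_{t < n} a_t X^t`. -/
noncomputable def coeffPoly (n : ℕ) (a : ℕ → F) : F[X] :=
  ∑ t ∈ Finset.range n, C (a t) * X ^ t

theorem coeff_coeffPoly (n : ℕ) (a : ℕ → F) (t : ℕ) :
    (coeffPoly n a).coeff t = if t < n then a t else 0 := by
  simp [coeffPoly, finsetSum_coeff, coeff_C_mul, coeff_X_pow]

theorem coeffPoly_mem_degreeLT (n : ℕ) (a : ℕ → F) : coeffPoly n a ∈ degreeLT F n := by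
  rw [mem_degreeLT, degree_lt_iff_coeff_zero]
  intro t ht
  rw [coeff_coeffPoly, if_neg (by omega)]

/-- The space spanned by the shifts of the forms `q i` that have `c` coefficients; this is the
row space of a resultant matrix. -/
noncomputable def shiftSpan {a : ℕ} (N : Fin a → ℕ) (q : Fin a → F[X]) (c : ℕ) : Submodule F F[X] :=
  Submodule.span F (Set.range fun p : Σ i : Fin a, Fin (c + 1 - N i) => X ^ (p.2 : ℕ) * q p.1)

instance {a : ℕ} (N : Fin a → ℕ) (q : Fin a → F[X]) (c : ℕ) :
    Module.Finite F (shiftSpan N q c) :=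
  FiniteDimensional.span_of_finite F (Set.finite_range _)

theorem finrank_degreeLT (n : ℕ) : finrank F (degreeLT F n) = n := by
  rw [(degreeLTEquiv F n).finrank_eq, finrank_fin_fun]

instance (n : ℕ) : Module.Finite F (degreeLT F n) :=
  Module.Finite.equiv (degreeLTEquiv F n).symm

/-- Row `(i, j)` is the coefficient vector of `X^j q_i`, and passing from vectors to polynomials is
injective. -/
theorem rank_resultantMatrix {a : ℕ} (N : Fin a → ℕ) (A : Fin a → ℕ → F) (c : ℕ) :
    (resultantMatrix N A c).rank = finrank F (shiftSpan N (fun i => coeffPoly (N i) (A i)) c) := by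
  rw [Matrix.rank_eq_finrank_span_row]
  let φ : (Fin c → F) →ₗ[F] F[X] := (degreeLT F c).subtype ∘ₗ (degreeLTEquiv F c).symm.toLinearMap
  have hφ : Function.Injective φ :=
    (Submodule.injective_subtype _).comp (degreeLTEquiv F c).symm.injective
  rw [(Submodule.equivMapOfInjective φ hφ _).finrank_eq, Submodule.map_span, ← Set.range_comp, shiftSpan]
  suffices h : φ ∘ (resultantMatrix N A c).row =
      fun p => X ^ (p.2 : ℕ) * coeffPoly (N p.1) (A p.1) by rw [h]
  funext p
  obtain ⟨i, j⟩ := p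
  have hmem : X ^ (j : ℕ) * coeffPoly (N i) (A i) ∈ degreeLT F c := by
    have := j.2
    exact mul_mem_degreeLT (coeffPoly_mem_degreeLT _ _) (natDegree_X_pow_le _) (by omega)
  have : (resultantMatrix N A c).row ⟨i, j⟩ = degreeLTEquiv F c ⟨_, hmem⟩ := by
    funext b
    simp only [resultantMatrix, Matrix.row, Matrix.of_apply, degreeLTEquiv, LinearEquiv.coe_mk,
      LinearMap.coe_mk, AddHom.coe_mk, coeff_X_pow_mul', coeff_coeffPoly]
    by_cases h : (j : ℕ) ≤ b <;> simp [h]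
  simp only [Function.comp, φ, LinearMap.comp_apply, LinearEquiv.coe_coe, this,
    LinearEquiv.symm_apply_apply, Submodule.subtype_apply]

/-- Every shift is `B` times a polynomial of degree less than `c - m`. -/
theorem finrank_shiftSpan_le {a : ℕ} {N : Fin a → ℕ} {q : Fin a → F[X]} {m : ℕ}
    (h : HasCommonFactor N q m) (c : ℕ) : finrank F (shiftSpan N q c) ≤ c - m := by
  obtain ⟨B, -, -, h⟩ := h
  have hle : shiftSpan N q c ≤ (degreeLT F (c - m)).map (LinearMap.mulLeft F B) := by
    rw [shiftSpan, Submodule.span_le]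
    rintro _ ⟨⟨i, j⟩, rfl⟩
    obtain ⟨v, hv, hqv⟩ := h i
    refine ⟨X ^ (j : ℕ) * v, mem_degreeLT_of_natDegree_lt fun h0 => ?_, ?_⟩
    · have hv0 : v ≠ 0 := right_ne_zero_of_mul h0
      have h1 := natDegree_lt_of_mem_degreeLT hv hv0
      have := j.2
      rw [natDegree_mul (by simp) hv0, natDegree_X_pow]
      omega
    · simp only [LinearMap.mulLeft_apply, hqv]; ring
  calc _ ≤ _ := Submodule.finrank_mono hle
    _ ≤ _ := Submodule.finrank_map_le _ _
    _ = _ := finrank_degreeLT _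

theorem mul_mem_shiftSpan {a : ℕ} {N : Fin a → ℕ} {q : Fin a → F[X]} {c n : ℕ} {B f u : F[X]}
    {v : Fin a → F[X]} (hqv : ∀ i, q i = B * v i) {I : Set (Fin a)} (hI : ∀ i ∈ I, N i ≤ n)
    (hf : f ∈ Submodule.span F (v '' I)) (hu : u ∈ degreeLT F (c + 1 - n)) :
    u * (B * f) ∈ shiftSpan N q c := by
  classical
  have h1 : Submodule.span F (v '' I) ≤
      (shiftSpan N q c).comap (LinearMap.mulLeft F u ∘ₗ LinearMap.mulLeft F B) := by
    rw [Submodule.span_le]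
    rintro _ ⟨i, hi, rfl⟩
    have h2 : degreeLT F (c + 1 - n) ≤ (shiftSpan N q c).comap (LinearMap.mulRight F (q i)) := by
      rw [degreeLT_eq_span_X_pow, Submodule.span_le]
      intro _ hx
      simp only [Finset.coe_image, Set.mem_image, Finset.coe_range, Set.mem_Iio] at hx
      obtain ⟨j, hj, rfl⟩ := hx
      have := hI i hi
      exact Submodule.subset_span ⟨⟨i, ⟨j, by omega⟩⟩, rfl⟩
    simpa [hqv, mul_assoc] using h2 hu
  exact h1 hf

/-- The map `(u, v) ↦ B (u f + v g)` into `W` is injective. -/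
theorem le_finrank_of_forall_mem {W : Submodule F F[X]} [Module.Finite F W] {f g B : F[X]}
    {α β : ℕ} (hB : B ≠ 0) (hf : ∀ u ∈ degreeLT F α, u * (B * f) ∈ W)
    (hg : ∀ u ∈ degreeLT F β, u * (B * g) ∈ W)
    (h : ∀ u ∈ degreeLT F α, ∀ v ∈ degreeLT F β, u * f + v * g = 0 → u = 0 ∧ v = 0) :
    α + β ≤ finrank F W := by
  let φ : (degreeLT F α × degreeLT F β) →ₗ[F] W :=
    ((LinearMap.mulRight F (B * f)).domRestrict (degreeLT F α)).codRestrict W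
        (fun u => hf u u.2) ∘ₗ LinearMap.fst F _ _ +
      ((LinearMap.mulRight F (B * g)).domRestrict (degreeLT F β)).codRestrict W
        (fun u => hg u u.2) ∘ₗ LinearMap.snd F _ _
  have hφ : Function.Injective φ := by
    rw [← LinearMap.ker_eq_bot, LinearMap.ker_eq_bot']
    rintro ⟨⟨u, hu⟩, ⟨v, hv⟩⟩ huv
    have h0 : u * (B * f) + v * (B * g) = 0 := congrArg Subtype.val huv
    have h1 : B * (u * f + v * g) = 0 := by linear_combination h0
    obtain ⟨rfl, rfl⟩ := h u hu v hv ((mul_eq_zero.1 h1).resolve_left hB)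
    rfl
  have := LinearMap.finrank_le_finrank_of_injective hφ
  rwa [finrank_prod, finrank_degreeLT, finrank_degreeLT] at this

variable [IsAlgClosed F]

/-- Let `q 0, …, q (s - 1)` be binary forms, the first `r` of degree `ν` and the others of degree
`ν - 1`. They have a common factor of degree `m` if and only if the row spaces of two resultant
matrices, one of all forms and one of those of degree `ν`, have small dimension. -/
theorem hasCommonFactor_iff_finrank_lt {N : ℕ → ℕ} {q : ℕ → F[X]} {r s ν m : ℕ}
    (hrs : r ≤ s) (hmν : m ≤ ν) (hq : ∀ i, q i ∈ degreeLT F (N i)) (hN : ∀ i < r, N i = ν + 1)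
    (hN' : ∀ i, r ≤ i → i < s → N i = ν) :
    HasCommonFactor (fun i : Fin s => N i) (fun i : Fin s => q i) m ↔
      finrank F (shiftSpan (fun i : Fin s => N i) (fun i : Fin s => q i) (2 * ν - m))
        < 2 * (ν - m) + 1 ∧
      finrank F (shiftSpan (fun i : Fin r => N i) (fun i : Fin r => q i) (2 * ν + 1 - m))
        < 2 * (ν - m) + 2 := by
  constructor
  · intro h
    have h' : HasCommonFactor (fun i : Fin r => N i) (fun i : Fin r => q i) m := by
      obtain ⟨B, hB, hBm, h⟩ := h
      exact ⟨B, hB, hBm, fun i => h (Fin.castLE hrs i)⟩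
    have h1 := finrank_shiftSpan_le h (2 * ν - m)
    have h2 := finrank_shiftSpan_le h' (2 * ν + 1 - m)
    omega
  rintro ⟨h1, h2⟩
  refine (hasCommonFactor_or (fun i : Fin s => hq i) m).resolve_right ?_
  rintro ⟨e, hem, B, hB, -, v, hv, hqv, hz, ht⟩
  -- `V` collects the cofactors of formal degree `ν - e`, `W` those of formal degree `ν - 1 - e`.
  set V := Submodule.span F (v '' {i | (i : ℕ) < r}) with hV
  set W := Submodule.span F (v '' {i | r ≤ (i : ℕ)}) with hW
  have mem : ∀ i, v i ∈ V ∧ (i : ℕ) < r ∨ v i ∈ W ∧ r ≤ (i : ℕ) := fun i => by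
    obtain h | h := lt_or_ge (i : ℕ) r
    · exact Or.inl ⟨Submodule.subset_span ⟨i, h, rfl⟩, h⟩
    · exact Or.inr ⟨Submodule.subset_span ⟨i, h, rfl⟩, h⟩
  have hz' : ∀ z, (∃ u ∈ V, u.eval z ≠ 0) ∨ ∃ u ∈ W, u.eval z ≠ 0 := fun z => by
    obtain ⟨i, hi⟩ := hz z
    exact (mem i).imp (fun h => ⟨_, h.1, hi⟩) (fun h => ⟨_, h.1, hi⟩)
  have ht' : (∃ u ∈ V, u.coeff (ν - e) ≠ 0) ∨ ∃ u ∈ W, u.coeff (ν - 1 - e) ≠ 0 := by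
    obtain ⟨i, hi⟩ := ht
    refine (mem i).imp (fun h => ⟨_, h.1, ?_⟩) (fun h => ⟨_, h.1, ?_⟩)
    · simp only [hN i h.2] at hi
      convert hi using 2
      omega
    · simp only [hN' i h.2 i.2] at hi
      convert hi using 2
      omega
  have hVS : ∀ f ∈ V, ∀ u ∈ degreeLT F (ν - m),
      u * (B * f) ∈ shiftSpan (fun i : Fin s => N i) (fun i : Fin s => q i) (2 * ν - m) :=
    fun f hf u hu => mul_mem_shiftSpan hqv (n := ν + 1) (fun i hi => (hN i hi).le) hf
      (by convert hu using 2; omega)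
  have hWS : ∀ f ∈ W, ∀ u ∈ degreeLT F (ν - m + 1),
      u * (B * f) ∈ shiftSpan (fun i : Fin s => N i) (fun i : Fin s => q i) (2 * ν - m) :=
    fun f hf u hu => mul_mem_shiftSpan hqv (n := ν) (fun i hi => (hN' i hi i.2).le) hf
      (by convert hu using 2; omega)
  have hVS' : ∀ f ∈ V, ∀ u ∈ degreeLT F (ν - m + 1),
      u * (B * f) ∈ shiftSpan (fun i : Fin r => N i) (fun i : Fin r => q i) (2 * ν + 1 - m) := by
    intro f hf u hu
    refine mul_mem_shiftSpan (v := fun i : Fin r => v (Fin.castLE hrs i)) (n := ν + 1)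
      (I := Set.univ) (fun i => hqv (Fin.castLE hrs i)) (fun i _ => (hN i i.2).le) ?_
      (by convert hu using 2; omega)
    refine Submodule.span_mono ?_ hf
    rintro _ ⟨i, hi, rfl⟩
    exact ⟨⟨i, hi⟩, trivial, rfl⟩
  have dl : ∀ {a b : ℕ} {u : F[X]}, a ≤ b → u ∈ degreeLT F a → u ∈ degreeLT F b :=
    fun hab hu => degreeLT_mono hab hu
  by_cases hW0 : W = ⊥
  · have e1 : ∀ u ∈ W, u = 0 := by simp [hW0]
    have hzV : ∀ z, ∃ u ∈ V, u.eval z ≠ 0 := fun z => (hz' z).resolve_right (by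
      rintro ⟨u, hu, h⟩; simp [e1 u hu] at h)
    have htV : ∃ u ∈ V, u.coeff (ν - e) ≠ 0 := ht'.resolve_right (by
      rintro ⟨u, hu, h⟩; simp [e1 u hu] at h)
    -- Only top-degree forms matter: two of them give `2 (ν - m + 1)` independent elements, against
    -- the second bound.
    obtain ⟨f, hf, g, hg, hfg, hgn⟩ := exists_mem_isCoprime hzV htV
    have := le_finrank_of_forall_mem hB (hVS' f hf) (hVS' g hg) fun a ha b _ hab =>
      eq_zero_of_isCoprime_of_add_eq_zero hfg hgn (dl (by omega) ha) hab
    omega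
  by_cases hV0 : V = ⊥
  · have e1 : ∀ u ∈ V, u = 0 := by simp [hV0]
    have hzW : ∀ z, ∃ u ∈ W, u.eval z ≠ 0 := fun z => (hz' z).resolve_left (by
      rintro ⟨u, hu, h⟩; simp [e1 u hu] at h)
    have htW : ∃ u ∈ W, u.coeff (ν - 1 - e) ≠ 0 := ht'.resolve_left (by
      rintro ⟨u, hu, h⟩; simp [e1 u hu] at h)
    obtain ⟨f, hf, g, hg, hfg, hgn⟩ := exists_mem_isCoprime hzW htW
    -- The multipliers of `f` are cut to degree less than `ν - m ≤ ν - 1 - e`, as independence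
    -- requires; the count `2 (ν - m) + 1` still violates the first bound.
    have := le_finrank_of_forall_mem hB (fun u hu => hWS f hf u (dl (by omega) hu)) (hWS g hg)
      (α := ν - m) fun a ha b _ hab =>
      eq_zero_of_isCoprime_of_add_eq_zero hfg hgn (dl (by omega) ha) hab
    omega
  obtain ⟨f, hf, g, hg, hfg, hfgn⟩ := exists_mem_mem_isCoprime hV0 hW0 hz' ht'
  -- One of `f`, `g` attains its formal degree, and that one bounds the multiplier of the other.
  have := le_finrank_of_forall_mem hB (hVS f hf) (hWS g hg) fun a ha b hb hab => by
    obtain hfn | hgn := hfgn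
    · exact (eq_zero_of_isCoprime_of_add_eq_zero hfg.symm hfn (dl (by omega) hb)
        (by rw [add_comm, hab])).symm
    · exact eq_zero_of_isCoprime_of_add_eq_zero hfg hgn (dl (by omega) ha) hab
  omega

end Shifts

/-! ### The `s`-decomposition and factors in `X^s`. -/

section Parts

open Polynomial

theorem sDecompLength_mul_add {K s i : ℕ} : (K + s - 1 - i) % s + s * sDecompLength K s i =
    K + s - 1 - i :=
  Nat.mod_add_div _ _

theorem sub_one_sub_mod_add_mul {k s m i : ℕ} (hi : i < s) :
    (k + s * m + s - 1 - i) % s = (k + s - 1 - i) % s := by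
  rw [show k + s * m + s - 1 - i = k + s - 1 - i + s * m by omega, Nat.add_mul_mod_self_left]

theorem sDecompLength_add_mul {k s m i : ℕ} (hi : i < s) :
    sDecompLength (k + s * m) s i = sDecompLength k s i + m := by
  unfold sDecompLength
  rw [show k + s * m + s - 1 - i = k + s - 1 - i + s * m by omega,
    Nat.add_mul_div_left _ _ (by omega)]

theorem sDecompLength_of_lt {K s i : ℕ} (hK : 0 < K) (hs : 0 < s)
    (hi : i < (K - 1) % s + 1) :
    sDecompLength K s i = (K - 1) / s + 1 := by
  have h1 := Nat.mod_add_div (K - 1) s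
  unfold sDecompLength
  have h2 := Nat.mod_lt (K - 1) hs
  rw [show K + s - 1 - i = ((K - 1) % s - i) + s * ((K - 1) / s + 1) by rw [mul_add]; omega,
    Nat.add_mul_div_left _ _ hs, Nat.div_eq_of_lt (by omega), zero_add]

theorem sDecompLength_of_le {K s i : ℕ} (hK : 0 < K) (hi : (K - 1) % s + 1 ≤ i) (his : i < s) :
    sDecompLength K s i = (K - 1) / s := by
  have h1 := Nat.mod_add_div (K - 1) s
  unfold sDecompLength
  rw [show K + s - 1 - i = ((K - 1) % s + s - i) + s * ((K - 1) / s) by omega,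
    Nat.add_mul_div_left _ _ (by omega), Nat.div_eq_of_lt (by omega), zero_add]

theorem injOn_sub_mod {K s : ℕ} : Set.InjOn (fun i => (K + s - 1 - i) % s) (Set.Iio s) := by
  intro i hi j hj hij
  simp only [Set.mem_Iio] at hi hj
  wlog h : i ≤ j generalizing i j
  · exact (this hij.symm hj hi (by omega)).symm
  have h1 : (K + s - 1 - i - (K + s - 1 - j)) % s = 0 :=
    Nat.sub_mod_eq_zero_of_mod_eq hij
  rw [Nat.mod_eq_of_lt (by omega)] at h1
  omega

variable {F : Type*} [Field F]

/-- The exponents of distinct summands lie in distinct residue classes mod `s`; hence the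
decomposition is unique. -/
theorem coeff_sum_X_pow_mul_expand {s : ℕ} {e : ℕ → ℕ} (he : Set.InjOn e (Set.Iio s))
    (hes : ∀ i < s, e i < s) (u : ℕ → F[X]) {i : ℕ} (hi : i < s) (t : ℕ) :
    (∑ j ∈ Finset.range s, X ^ e j * expand F s (u j)).coeff (e i + s * t) = (u i).coeff t := by
  have hs : 0 < s := by omega
  rw [finsetSum_coeff, Finset.sum_eq_single i]
  · rw [coeff_X_pow_mul', if_pos (by omega), Nat.add_sub_cancel_left, mul_comm,
      coeff_expand_mul hs]
  · intro j hj hji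
    rw [Finset.mem_range] at hj
    rw [coeff_X_pow_mul']
    split_ifs with h
    · rw [coeff_expand hs, if_neg]
      intro hdvd
      apply hji
      apply he hj hi
      have h1 : e i + s * t ≡ e j [MOD s] := ((Nat.modEq_iff_dvd' h).2 hdvd).symm
      have h2 : e i ≡ e j [MOD s] := by simpa [Nat.ModEq] using h1
      rw [Nat.ModEq, Nat.mod_eq_of_lt (hes i hi), Nat.mod_eq_of_lt (hes j hj)] at h2
      exact h2.symm
    · rfl
  · intro h
    exact absurd (Finset.mem_range.2 hi) h

/-- The `i`-th form of the `s`-decomposition of the form with coefficients `P.coeff 0, …,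
P.coeff (K - 1)`. -/
noncomputable def formPart (K s : ℕ) (P : F[X]) (i : ℕ) : F[X] :=
  coeffPoly (sDecompLength K s i) fun t => P.coeff ((K + s - 1 - i) % s + s * t)

theorem formPart_mem_degreeLT (K s : ℕ) (P : F[X]) (i : ℕ) :
    formPart K s P i ∈ degreeLT F (sDecompLength K s i) :=
  coeffPoly_mem_degreeLT _ _

theorem coeff_eq_zero_of_mem_degreeLT {P : F[X]} {n t : ℕ} (hP : P ∈ degreeLT F n) (ht : n ≤ t) :
    P.coeff t = 0 := by
  rw [mem_degreeLT, degree_lt_iff_coeff_zero] at hP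
  exact hP t ht

theorem coeff_formPart {K s i : ℕ} {P : F[X]} (hP : P ∈ degreeLT F K) (hi : i < s) (t : ℕ) :
    (formPart K s P i).coeff t = P.coeff ((K + s - 1 - i) % s + s * t) := by
  rw [formPart, coeff_coeffPoly]
  split_ifs with h
  · rfl
  · have h1 := sDecompLength_mul_add (K := K) (s := s) (i := i)
    have h2 : s * sDecompLength K s i ≤ s * t := Nat.mul_le_mul_left s (by omega)
    rw [coeff_eq_zero_of_mem_degreeLT hP (by omega)]

theorem sum_formPart {K s : ℕ} (hs : 0 < s) {P : F[X]} (hP : P ∈ degreeLT F K) :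
    ∑ i ∈ Finset.range s, X ^ ((K + s - 1 - i) % s) * expand F s (formPart K s P i) = P := by
  -- Dehomogenization at `x = 1`, `y = X`.
  have h := sDecomp_eq hs (fun j : Fin K => C (P.coeff j)) 1 X
  simp only [one_pow, mul_one, one_mul] at h
  have h1 : ∑ j : Fin K, C (P.coeff j) * X ^ (j : ℕ) = P := by
    rw [Fin.sum_univ_eq_sum_range (fun j => C (P.coeff j) * X ^ j) K]
    by_cases hP0 : P = 0
    · simp [hP0]
    · exact (P.as_sum_range_C_mul_X_pow' (natDegree_lt_of_mem_degreeLT hP hP0)).symm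
  rw [h1] at h
  refine Eq.trans ?_ h.symm
  refine Finset.sum_congr rfl fun i hi => ?_
  rw [formPart, coeffPoly, map_sum]
  congr 1
  refine Finset.sum_congr rfl fun t _ => ?_
  simp only [map_mul, map_pow, expand_C, expand_X]
  congr 1
  unfold sDecompCoeff
  split_ifs with hlt
  · rfl
  · rw [coeff_eq_zero_of_mem_degreeLT hP (by omega), C_0]

theorem formPart_sum {K s i : ℕ} {u : ℕ → F[X]} (hi : i < s)
    (hP : ∑ j ∈ Finset.range s, X ^ ((K + s - 1 - j) % s) * expand F s (u j) ∈ degreeLT F K) :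
    formPart K s (∑ j ∈ Finset.range s, X ^ ((K + s - 1 - j) % s) * expand F s (u j)) i = u i := by
  ext t
  rw [coeff_formPart hP hi]
  exact coeff_sum_X_pow_mul_expand injOn_sub_mod (fun i _ => Nat.mod_lt _ (by omega)) u hi t

theorem sum_mem_degreeLT {K s : ℕ} {u : ℕ → F[X]}
    (hu : ∀ i < s, u i ∈ degreeLT F (sDecompLength K s i)) :
    ∑ j ∈ Finset.range s, X ^ ((K + s - 1 - j) % s) * expand F s (u j) ∈ degreeLT F K := by
  refine Submodule.sum_mem _ fun i hi => mem_degreeLT_of_natDegree_lt fun h0 => ?_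
  rw [Finset.mem_range] at hi
  have hs : 0 < s := by omega
  have h1 : expand F s (u i) ≠ 0 := right_ne_zero_of_mul h0
  have h2 : u i ≠ 0 := by rintro h; simp [h] at h1
  have h3 := natDegree_lt_of_mem_degreeLT (hu i hi) h2
  rw [natDegree_mul (by simp) h1, natDegree_X_pow, natDegree_expand]
  have h4 := sDecompLength_mul_add (K := K) (s := s) (i := i)
  have h5 : s * ((u i).natDegree + 1) ≤ s * sDecompLength K s i := Nat.mul_le_mul_left s h3
  rw [mul_add, mul_one, mul_comm s (natDegree _)] at h5
  omega

theorem mul_expand_mem_degreeLT {k s m : ℕ} {A B : F[X]} (hA : A ∈ degreeLT F k)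
    (hB : B ∈ degreeLT F (m + 1)) : A * expand F s B ∈ degreeLT F (k + s * m) := by
  rw [mul_comm A]
  refine mul_mem_degreeLT hA (b := s * m) ?_ le_rfl
  rw [natDegree_expand, mul_comm]
  refine Nat.mul_le_mul_left s ?_
  by_cases h0 : B = 0
  · simp [h0]
  · have := natDegree_lt_of_mem_degreeLT hB h0
    omega

/-- A factor in `X^s` preserves residue classes of exponents, so it multiplies each part separately.
-/
theorem formPart_mul_expand {k s m i : ℕ} {A B : F[X]} (hA : A ∈ degreeLT F k)
    (hB : B ∈ degreeLT F (m + 1)) (hi : i < s) :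
    formPart (k + s * m) s (A * expand F s B) i = formPart k s A i * B := by
  have hs : 0 < s := by omega
  have h1 : A * expand F s B = ∑ j ∈ Finset.range s,
      X ^ ((k + s * m + s - 1 - j) % s) * expand F s (formPart k s A j * B) := by
    conv_lhs => rw [← sum_formPart hs hA, Finset.sum_mul]
    refine Finset.sum_congr rfl fun j hj => ?_
    rw [sub_one_sub_mod_add_mul (Finset.mem_range.1 hj), map_mul, mul_assoc]
  have h2 := mul_expand_mem_degreeLT (s := s) hA hB
  rw [h1] at h2 ⊢
  exact formPart_sum (u := fun j => formPart k s A j * B) hi h2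

theorem exists_eq_mul_expand_iff {k s m : ℕ} (hs : 0 < s) {P : F[X]}
    (hP : P ∈ degreeLT F (k + s * m)) :
    (∃ A ∈ degreeLT F k, ∃ B ∈ degreeLT F (m + 1), P = A * expand F s B) ↔
      HasCommonFactor (fun i : Fin s => sDecompLength (k + s * m) s i)
        (fun i : Fin s => formPart (k + s * m) s P i) m := by
  constructor
  · rintro ⟨A, hA, B, hB, rfl⟩
    by_cases hB0 : B = 0
    -- The common factor must be nonzero, so `B = 0` is replaced by `1` with zero cofactors.
    · refine ⟨1, one_ne_zero, by simp, fun i => ⟨0, zero_mem _, ?_⟩⟩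
      simp only [formPart_mul_expand hA hB i.2]
      rw [hB0, mul_zero, mul_zero]
    · refine ⟨B, hB0, Nat.lt_succ_iff.1 (natDegree_lt_of_mem_degreeLT hB hB0), fun i =>
        ⟨formPart k s A i, ?_, by simp only [formPart_mul_expand hA hB i.2, mul_comm]⟩⟩
      simp only [sDecompLength_add_mul i.2, Nat.add_sub_cancel]
      exact formPart_mem_degreeLT _ _ _ _
  · rintro ⟨B, hB0, hB, h⟩
    choose a ha haP using h
    let u : ℕ → F[X] := fun i => if h : i < s then a ⟨i, h⟩ else 0
    refine ⟨∑ j ∈ Finset.range s, X ^ ((k + s - 1 - j) % s) * expand F s (u j),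
      sum_mem_degreeLT fun i hi => ?_, B,
      mem_degreeLT_of_natDegree_lt fun _ => Nat.lt_succ_iff.2 hB, ?_⟩
    · have := ha ⟨i, hi⟩
      simp only [sDecompLength_add_mul hi, Nat.add_sub_cancel] at this
      simpa only [u, dif_pos hi] using this
    · conv_lhs => rw [← sum_formPart hs hP]
      rw [Finset.sum_mul]
      refine Finset.sum_congr rfl fun j hj => ?_
      have hj := Finset.mem_range.1 hj
      rw [sub_one_sub_mod_add_mul hj, mul_assoc, ← map_mul]
      have := haP ⟨j, hj⟩
      simp only at this
      simp only [u, dif_pos hj, this, mul_comm]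

end Parts

/-! ### Factorizations along an architecture. -/

section FilterProducts

open Polynomial

variable {F : Type*} [Field F]

/-- The products `A₁(X) A₂(X^{s₁}) A₃(X^{s₁ s₂}) ⋯` with `A_ℓ` of degree less than `k_ℓ`. -/
def filterProducts (F : Type*) [Field F] : List (ℕ × ℕ) → Set F[X]
  | [] => {1}
  | (k, s) :: rest => {P | ∃ A ∈ degreeLT F k, ∃ T ∈ filterProducts F rest, P = A * expand F s T}

theorem filterSize_pos {arch : List (ℕ × ℕ)} (h : ∀ layer ∈ arch, 0 < layer.1 ∧ 0 < layer.2) :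
    0 < filterSize arch := by
  cases arch with
  | nil => exact one_pos
  | cons layer rest => exact Nat.add_pos_left (h layer (by simp)).1 _

theorem mem_degreeLT_of_mem_filterProducts {arch : List (ℕ × ℕ)}
    (h : ∀ layer ∈ arch, 0 < layer.1 ∧ 0 < layer.2) {P : F[X]} (hP : P ∈ filterProducts F arch) :
    P ∈ degreeLT F (filterSize arch) := by
  induction arch generalizing P with
  | nil =>
    obtain rfl : P = 1 := hP
    exact mem_degreeLT_of_natDegree_lt fun _ => by simp [filterSize]
  | cons layer rest ih =>
    obtain ⟨k, s⟩ := layer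
    obtain ⟨A, hA, T, hT, rfl⟩ := hP
    have hrest : ∀ layer ∈ rest, 0 < layer.1 ∧ 0 < layer.2 := fun l hl => h l (by simp [hl])
    refine mul_expand_mem_degreeLT hA ?_
    rw [Nat.sub_add_cancel (filterSize_pos hrest)]
    exact ih hrest hT

theorem mem_filterProducts_pair {k s k' s' : ℕ} {P : F[X]} :
    P ∈ filterProducts F [(k, s), (k', s')] ↔
      ∃ A ∈ degreeLT F k, ∃ B ∈ degreeLT F k', P = A * expand F s B := by
  simp [filterProducts]

/-- If `U(X) T(X^s)` is divisible by a polynomial in `X^s` of degree `m` more than that of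
`T(X^s)`, then a factor of degree `m` in `X^s` splits off from `U`. -/
theorem exists_eq_mul_expand_of_mul_expand_eq [IsAlgClosed F] {k s m τ : ℕ} (hs : 0 < s)
    {U T A D : F[X]} (hU : U ∈ degreeLT F (k + s * m)) (hT : T ∈ degreeLT F (τ + 1))
    (hA : A ∈ degreeLT F k) (hD : D ∈ degreeLT F (m + τ + 1)) (hT0 : T ≠ 0) (hD0 : D ≠ 0)
    (h : U * expand F s T = A * expand F s D) :
    ∃ A' ∈ degreeLT F k, ∃ B ∈ degreeLT F (m + 1), U = A' * expand F s B := by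
  rw [exists_eq_mul_expand_iff hs hU]
  refine (hasCommonFactor_or (fun i : Fin s => formPart_mem_degreeLT _ s U i) m).resolve_right ?_
  rintro ⟨e, hem, B, hB0, -, v, hv, hqv, hz, i, hi⟩
  have key : ∀ i : Fin s, v i * (B * T) = formPart k s A i * D := fun i => by
    have h1 := formPart_mul_expand hU hT i.2
    have h2 := formPart_mul_expand hA hD i.2
    rw [h, show k + s * m + s * τ = k + s * (m + τ) by ring, h2, hqv] at h1
    rw [h1]; ring
  have hdvd : ∀ f ∈ Submodule.span F (Set.range v), D ∣ f * (B * T) := fun f hf => by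
    induction hf using Submodule.span_induction with
    | mem x hx => obtain ⟨j, rfl⟩ := hx; exact ⟨_, by rw [key, mul_comm]⟩
    | zero => simp
    | add x y _ _ hx hy => rw [add_mul]; exact dvd_add hx hy
    | smul c x _ hx => rw [smul_mul_assoc]; exact by rw [smul_eq_C_mul]; exact hx.mul_left _
  have hi' : v i ∈ Submodule.span F (Set.range v) := Submodule.subset_span ⟨i, rfl⟩
  -- `D` divides `f B T` and `g B T` for coprime `f`, `g`, hence `B T`.
  obtain ⟨f, hf, g, hg, ⟨x, y, hxy⟩, -⟩ := exists_mem_isCoprime (V := Submodule.span F (Set.range v))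
    (fun z => (hz z).imp' v fun j hj => ⟨Submodule.subset_span ⟨j, rfl⟩, hj⟩) ⟨_, hi', hi⟩
  have hD : D ∣ B * T := by
    have : B * T = x * (f * (B * T)) + y * (g * (B * T)) := by linear_combination -(B * T) * hxy
    rw [this]
    exact dvd_add ((hdvd f hf).mul_left _) ((hdvd g hg).mul_left _)
  have hBT : B * T ≠ 0 := mul_ne_zero hB0 hT0
  have hv0 : v i ≠ 0 := by intro h0; simp [h0] at hi
  have hA0 : formPart k s A i ≠ 0 := by
    intro h0
    have := key i
    rw [h0, zero_mul] at this
    exact mul_ne_zero hv0 hBT this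
  -- Now `deg D ≤ deg (B T)` gives `deg v_i ≤ deg a_i`, where `a_i` is the part of `A`. But `v_i`
  -- attains its formal degree, which exceeds that of `a_i` by `m - e > 0`.
  have h1 := congrArg natDegree (key i)
  rw [natDegree_mul hv0 hBT, natDegree_mul hA0 hD0] at h1
  have h2 := natDegree_le_of_dvd hD hBT
  have h3 := natDegree_lt_of_mem_degreeLT (formPart_mem_degreeLT k s A i) hA0
  have h4 := natDegree_lt_of_mem_degreeLT (hv i) hv0
  have h5 := le_natDegree_of_ne_zero hi
  simp only [sDecompLength_add_mul i.2] at h4 h5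
  omega

/-- For the converse, `exists_eq_mul_expand_of_mul_expand_eq` with `T(X^{s₂})` in place of `T`
splits the merged first factor. It needs nonzero `T` and `D`, so the zero polynomial is treated
apart. -/
theorem mem_filterProducts_cons_cons_iff [IsAlgClosed F] {k₁ s₁ k₂ s₂ : ℕ} {rest : List (ℕ × ℕ)}
    (hs₁ : 0 < s₁) (hk₂ : 0 < k₂) (hrest : ∀ layer ∈ rest, 0 < layer.1 ∧ 0 < layer.2) {P : F[X]} :
    P ∈ filterProducts F ((k₁, s₁) :: (k₂, s₂) :: rest) ↔
      P ∈ filterProducts F ((k₁ + s₁ * (k₂ - 1), s₁ * s₂) :: rest) ∧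
      P ∈ filterProducts F [(k₁, s₁), (k₂ + s₂ * (filterSize rest - 1), 1)] := by
  obtain ⟨m, rfl⟩ : ∃ m, k₂ = m + 1 := ⟨k₂ - 1, by omega⟩
  obtain ⟨τ, hτ⟩ : ∃ τ, filterSize rest = τ + 1 :=
    ⟨filterSize rest - 1, by have := filterSize_pos hrest; omega⟩
  have hsize : ∀ {T}, T ∈ filterProducts F rest → expand F s₂ T ∈ degreeLT F (s₂ * τ + 1) := by
    intro T hT
    have h1 := mem_degreeLT_of_mem_filterProducts hrest hT
    rw [hτ] at h1
    have := mul_expand_mem_degreeLT (s := s₂) (k := 1) (A := 1)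
      (mem_degreeLT_of_natDegree_lt fun _ => by simp) h1
    rwa [one_mul, add_comm] at this
  rw [mem_filterProducts_pair, hτ]
  simp only [Nat.add_sub_cancel]
  constructor
  · rintro ⟨A, hA, _, ⟨B, hB, T, hT, rfl⟩, rfl⟩
    refine ⟨⟨A * expand F s₁ B, mul_expand_mem_degreeLT hA hB, T, hT, ?_⟩, A, hA, _,
      mul_expand_mem_degreeLT hB (hτ ▸ mem_degreeLT_of_mem_filterProducts hrest hT), rfl⟩
    rw [map_mul, expand_expand, mul_assoc]
  · rintro ⟨⟨U, hU, T, hT, rfl⟩, A, hA, D, hD, h⟩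
    by_cases h0 : U * expand F (s₁ * s₂) T = 0
    · exact ⟨0, zero_mem _, 0 * expand F s₂ T, ⟨0, zero_mem _, T, hT, rfl⟩, by simp [h0]⟩
    have hT0 : expand F s₂ T ≠ 0 := by
      intro h1
      rw [expand_mul, h1] at h0
      simp at h0
    have hD0 : D ≠ 0 := by
      rintro rfl
      rw [h] at h0
      simp at h0
    rw [expand_mul] at h
    obtain ⟨A', hA', B, hB, rfl⟩ := exists_eq_mul_expand_of_mul_expand_eq hs₁ hU (hsize hT) hA
      (by convert hD using 2; omega) hT0 hD0 h
    refine ⟨A', hA', _, ⟨B, hB, T, hT, rfl⟩, ?_⟩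
    rw [map_mul, expand_expand, mul_assoc]

end FilterProducts

/-! ### From convolutions to polynomials. -/

section Convolutions

open Polynomial

/-- The polynomial `∑_j w_j X^j` of a filter `w`. -/
noncomputable def filterPoly {F : Type*} [Field F] {n : ℕ} (w : Fin n → F) : F[X] :=
  (degreeLTEquiv F n).symm w

section

variable {F : Type*} [Field F] {n : ℕ}

theorem filterPoly_eq_sum (w : Fin n → F) : filterPoly w = ∑ j : Fin n, monomial (j : ℕ) (w j) := rfl

theorem filterPoly_mem_degreeLT (w : Fin n → F) : filterPoly w ∈ degreeLT F n :=
  ((degreeLTEquiv F n).symm w).2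

theorem coeff_filterPoly (w : Fin n → F) (j : Fin n) : (filterPoly w).coeff j = w j :=
  congrFun ((degreeLTEquiv F n).apply_symm_apply w) j

theorem exists_filterPoly_eq {P : F[X]} (hP : P ∈ degreeLT F n) :
    ∃ w : Fin n → F, filterPoly w = P :=
  ⟨degreeLTEquiv F n ⟨P, hP⟩, by rw [filterPoly, LinearEquiv.symm_apply_apply]⟩

/-- The linear functional `X^n ↦ y n` on polynomials. -/
noncomputable def pairing (y : ℕ → F) : F[X] →ₗ[F] F :=
  Polynomial.lsum fun n => LinearMap.toSpanSingleton F F (y n)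

theorem pairing_monomial (y : ℕ → F) (n : ℕ) (c : F) : pairing y (monomial n c) = c * y n := by
  simp [pairing, Polynomial.lsum_apply]

/-- Multiplying by `X^n` shifts the sequence; this turns composition of convolutions into
multiplication of polynomials. -/
theorem pairing_mul_monomial (y : ℕ → F) (P : F[X]) (n : ℕ) (c : F) :
    pairing y (P * monomial n c) = c * pairing (fun t => y (n + t)) P := by
  induction P using Polynomial.induction_on' with
  | add p q hp hq => rw [add_mul, map_add, hp, hq, map_add, mul_add]
  | monomial m a =>
    rw [monomial_mul_monomial, pairing_monomial, pairing_monomial, add_comm m n]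
    ring

end

/-- Extension of a vector by zero. -/
def extendZero {d : ℕ} (x : Fin d → ℂ) (n : ℕ) : ℂ := if h : n < d then x ⟨n, h⟩ else 0

theorem convolution_apply {k d d' s : ℕ} (w : Fin k → ℂ) (h : d = s * (d' - 1) + k)
    (x : Fin d → ℂ) (i : Fin d') :
    convolution w s h x i = pairing (fun n => extendZero x (i * s + n)) (filterPoly w) := by
  rw [filterPoly_eq_sum, map_sum]
  simp only [convolution, LinearMap.coe_mk, AddHom.coe_mk, pairing_monomial]
  refine Finset.sum_congr rfl fun j _ => ?_
  rw [extendZero, dif_pos]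

theorem convolution_comp {k₁ k₂ k₃ d₀ d₁ d s t : ℕ} {w₁ : Fin k₁ → ℂ} {w₂ : Fin k₂ → ℂ}
    {w₃ : Fin k₃ → ℂ} (h₁ : d₀ = s * (d₁ - 1) + k₁) (h₂ : d₁ = t * (d - 1) + k₂)
    (h₃ : d₀ = s * t * (d - 1) + k₃)
    (hw : filterPoly w₃ = filterPoly w₁ * expand ℂ s (filterPoly w₂)) :
    convolution w₂ t h₂ ∘ₗ convolution w₁ s h₁ = convolution w₃ (s * t) h₃ := by
  refine LinearMap.ext fun x => funext fun i => ?_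
  rw [convolution_apply, hw, filterPoly_eq_sum w₂, map_sum, Finset.mul_sum, map_sum]
  change ∑ j : Fin k₂, w₂ j * convolution w₁ s h₁ x ⟨i * t + j, _⟩ = _
  refine Finset.sum_congr rfl fun j _ => ?_
  rw [expand_monomial, pairing_mul_monomial, convolution_apply]
  congr 2
  refine congrArg pairing (funext fun n => congrArg (extendZero x) ?_)
  simp only
  ring

/-- The zeroth output at the unit vectors reads off the filter, which is where a positive output
dimension enters. -/
theorem convolution_injective {k d d' s : ℕ} (h : d = s * (d' - 1) + k) (hd' : 0 < d')
    {w w' : Fin k → ℂ} (hw : convolution w s h = convolution w' s h) : w = w' := by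
  have key : ∀ (w : Fin k → ℂ) (j : Fin k),
      convolution w s h (Pi.single ⟨j, by have := j.2; omega⟩ 1) ⟨0, hd'⟩ = w j := by
    intro w j
    simp only [convolution, LinearMap.coe_mk, AddHom.coe_mk]
    rw [Finset.sum_eq_single j]
    · simp
    · intro b _ hb
      rw [Pi.single_eq_of_ne, mul_zero]
      intro h0
      apply hb
      ext
      simpa using congrArg Fin.val h0
    · simp
  funext j
  rw [← key w j, ← key w' j, hw]

theorem totalStride_cons (k s : ℕ) (rest : List (ℕ × ℕ)) :
    totalStride ((k, s) :: rest) = s * totalStride rest := by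
  simp [totalStride]

theorem isNetworkMap_iff {d : ℕ} (arch : List (ℕ × ℕ)) (hne : arch ≠ [])
    (hpos : ∀ layer ∈ arch, 0 < layer.1 ∧ 0 < layer.2) {n S d₀ : ℕ} (hn : n = filterSize arch)
    (hS : S = totalStride arch) (φ : (Fin d₀ → ℂ) →ₗ[ℂ] (Fin d → ℂ)) :
    IsNetworkMap arch d₀ d φ ↔ ∃ (h : d₀ = S * (d - 1) + n) (w : Fin n → ℂ),
      filterPoly w ∈ filterProducts ℂ arch ∧ φ = convolution w S h := by
  induction arch generalizing n S d₀ with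
  | nil => exact absurd rfl hne
  | cons layer rest ih =>
    obtain ⟨k, s⟩ := layer
    cases rest with
    | nil =>
      obtain rfl : n = k := by simp [hn, filterSize]
      obtain rfl : S = s := by simp [hS, totalStride]
      rw [IsNetworkMap]
      refine exists_congr fun h => exists_congr fun w => ?_
      rw [eq_comm (a := φ)]
      refine ⟨fun hw => ⟨⟨_, filterPoly_mem_degreeLT w, 1, rfl, by simp⟩, hw⟩, fun hw => hw.2⟩
    | cons layer rest =>
      have hpos' : ∀ l ∈ layer :: rest, 0 < l.1 ∧ 0 < l.2 := fun l hl => hpos l (by simp [hl])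
      have hsize := filterSize_pos hpos'
      rw [totalStride_cons] at hS
      rw [filterSize] at hn
      have hdim : ∀ d₁, d₁ = totalStride (layer :: rest) * (d - 1) + filterSize (layer :: rest) →
          s * (d₁ - 1) + k = S * (d - 1) + n := by
        rintro d₁ rfl
        obtain ⟨m, hm⟩ : ∃ m, filterSize (layer :: rest) = m + 1 :=
          ⟨_, (Nat.sub_add_cancel hsize).symm⟩
        rw [hn, hS, hm]
        simp only [← add_assoc, Nat.add_sub_cancel]
        ring
      rw [IsNetworkMap]
      constructor
      · rintro ⟨d₁, -, h₁, w₁, ψ, hψ, rfl⟩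
        obtain ⟨h₂, w₂, hw₂, rfl⟩ := (ih (by simp) hpos' rfl rfl ψ).1 hψ
        have hmem : filterPoly w₁ * expand ℂ s (filterPoly w₂) ∈ degreeLT ℂ n := by
          rw [hn]
          refine mul_expand_mem_degreeLT (filterPoly_mem_degreeLT w₁) ?_
          rw [Nat.sub_add_cancel hsize]
          exact filterPoly_mem_degreeLT w₂
        obtain ⟨w, hw⟩ := exists_filterPoly_eq hmem
        refine ⟨h₁.trans (hdim _ h₂), w,
          hw ▸ ⟨_, filterPoly_mem_degreeLT w₁, _, hw₂, rfl⟩, ?_⟩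
        subst hS
        exact convolution_comp h₁ h₂ _ hw
      · rintro ⟨h, w, ⟨A, hA, T, hT, hw⟩, rfl⟩
        obtain ⟨w₁, rfl⟩ := exists_filterPoly_eq hA
        obtain ⟨w₂, rfl⟩ := exists_filterPoly_eq (mem_degreeLT_of_mem_filterProducts hpos' hT)
        refine ⟨totalStride (layer :: rest) * (d - 1) + filterSize (layer :: rest), by omega,
          h.trans (hdim _ rfl).symm, w₁, convolution w₂ (totalStride (layer :: rest)) rfl,
          (ih (by simp) hpos' rfl rfl _).2 ⟨rfl, w₂, hT, rfl⟩, ?_⟩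
        subst hS
        exact (convolution_comp _ rfl h hw).symm

theorem mem_complexNeurovariety_iff {arch : List (ℕ × ℕ)} (hne : arch ≠ [])
    (hpos : ∀ layer ∈ arch, 0 < layer.1 ∧ 0 < layer.2) {d : ℕ} (hd : 0 < d)
    (w : Fin (filterSize arch) → ℂ) :
    w ∈ complexNeurovariety arch d ↔ filterPoly w ∈ filterProducts ℂ arch := by
  rw [complexNeurovariety, Set.mem_ofPred_eq, isNetworkMap_iff arch hne hpos rfl rfl]
  constructor
  · rintro ⟨h, w', hw', hww'⟩
    rwa [convolution_injective h hd hww']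
  · intro hw
    exact ⟨rfl, w, hw, rfl⟩

end Convolutions

/-! ### Zero loci of the ideals of the algorithm. -/

section Vanishing

open MvPolynomial

theorem mem_zeroLocus_iff_le {K : ℕ} {I : Ideal (MvPolynomial (Fin K) ℂ)} {w : Fin K → ℂ} :
    w ∈ zeroLocus ℂ I ↔ I ≤ vanishingIdeal ℂ {w} := by
  rw [← le_zeroLocus_iff_le_vanishingIdeal]
  exact Set.singleton_subset_iff.symm

/-- The ideal of a point is prime, so it contains a radical as soon as it contains the ideal itself.
-/
theorem mem_zeroLocus_radical_add_iff {K : ℕ} {I J : Ideal (MvPolynomial (Fin K) ℂ)}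
    {w : Fin K → ℂ} :
    w ∈ zeroLocus ℂ (I + J).radical ↔ w ∈ zeroLocus ℂ I ∧ w ∈ zeroLocus ℂ J := by
  have h : (vanishingIdeal ℂ {w} : Ideal (MvPolynomial (Fin K) ℂ)).IsRadical :=
    Ideal.IsPrime.isRadical inferInstance
  simp only [mem_zeroLocus_iff_le, h.radical_le_iff, Submodule.add_eq_sup, sup_le_iff]

theorem map_sDecompCoeff {R R' : Type*} [CommRing R] [CommRing R'] (f : R →+* R') {K : ℕ}
    (w : Fin K → R) (s i t : ℕ) :
    f (sDecompCoeff w s i t) = sDecompCoeff (fun j => f (w j)) s i t := by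
  unfold sDecompCoeff
  split_ifs <;> simp

theorem map_resultantMatrix {R R' : Type*} [CommRing R] [CommRing R'] (f : R →+* R') {a : ℕ}
    (N : Fin a → ℕ) (A : Fin a → ℕ → R) (c : ℕ) :
    (resultantMatrix N A c).map f = resultantMatrix N (fun i t => f (A i t)) c := by
  ext p b
  simp only [resultantMatrix, Matrix.map_apply, Matrix.of_apply]
  split_ifs <;> simp

theorem coeffPoly_sDecompCoeff {K : ℕ} (w : Fin K → ℂ) (s i : ℕ) :
    coeffPoly (sDecompLength K s i) (sDecompCoeff w s i) = formPart K s (filterPoly w) i := by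
  rw [formPart]
  congr 1
  funext t
  unfold sDecompCoeff
  split_ifs with h
  · exact (coeff_filterPoly w ⟨_, h⟩).symm
  · exact (coeff_eq_zero_of_mem_degreeLT (filterPoly_mem_degreeLT w) (by omega)).symm

/-- Evaluation at `w` commutes with determinants, so the generic minors specialize to those of the
matrix of `w`. -/
theorem mem_zeroLocus_minorIdeal_iff {K : ℕ} (a s c p : ℕ) (w : Fin K → ℂ) :
    w ∈ zeroLocus ℂ (minorIdeal (resultantMatrix (a := a) (fun i => sDecompLength K s i)
      (fun i => sDecompCoeff (X (R := ℂ) (σ := Fin K)) s i) c) p) ↔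
      Module.finrank ℂ (shiftSpan (fun i : Fin a => sDecompLength K s i)
        (fun i : Fin a => formPart K s (filterPoly w) i) c) < p := by
  rw [← funext fun i : Fin a => coeffPoly_sDecompCoeff w s i, ← rank_resultantMatrix, ← Matrix.forall_minor_eq_zero_iff_rank_lt, minorIdeal, zeroLocus_span,
    Set.mem_ofPred_eq]
  have key : ∀ (f : Fin p ↪ (Σ i : Fin a, Fin (c + 1 - sDecompLength K s i))) (g : Fin p ↪ Fin c),
      aeval w ((resultantMatrix (a := a) (fun i => sDecompLength K s i)
        (fun i => sDecompCoeff (X (R := ℂ) (σ := Fin K)) s i) c).submatrix f g).det =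
      ((resultantMatrix (a := a) (fun i => sDecompLength K s i)
        (fun i => sDecompCoeff w s i) c).submatrix f g).det := by
    intro f g
    rw [AlgHom.map_det, AlgHom.mapMatrix_apply, ← Matrix.submatrix_map]
    have h := map_resultantMatrix (aeval (R := ℂ) w).toRingHom (a := a)
      (fun i => sDecompLength K s i) (fun i => sDecompCoeff (X (R := ℂ) (σ := Fin K)) s i) c
    simp only [map_sDecompCoeff] at h
    simp only [AlgHom.toRingHom_eq_coe, RingHom.coe_coe, aeval_X] at h
    rw [h]
  constructor
  · intro h f g
    rw [← key]
    exact h _ ⟨f, g, rfl⟩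
  · rintro h _ ⟨f, g, rfl⟩
    rw [key, h]

theorem mem_zeroLocus_vanish_pair_iff {K k₁ s₁ k₂ s₂ : ℕ} (hk₁ : 0 < k₁) (hs₁ : 0 < s₁)
    (hk₂ : 0 < k₂) (hK : K = k₁ + s₁ * (k₂ - 1)) (w : Fin K → ℂ) :
    w ∈ zeroLocus ℂ (vanish K [(k₁, s₁), (k₂, s₂)]) ↔
      filterPoly w ∈ filterProducts ℂ [(k₁, s₁), (k₂, s₂)] := by
  obtain ⟨m, rfl⟩ : ∃ m, k₂ = m + 1 := ⟨k₂ - 1, by omega⟩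
  rw [Nat.add_sub_cancel] at hK
  have hK0 : 0 < K := by omega
  have hm : m ≤ (K - 1) / s₁ := by
    rw [Nat.le_div_iff_mul_le hs₁, mul_comm]
    omega
  rw [vanish, mem_zeroLocus_radical_add_iff, minorIdealOne, minorIdealTwo,
    mem_zeroLocus_minorIdeal_iff, mem_zeroLocus_minorIdeal_iff, mem_filterProducts_pair]
  have hw : filterPoly w ∈ Polynomial.degreeLT ℂ (k₁ + s₁ * m) := by
    rw [← hK]
    exact filterPoly_mem_degreeLT w
  have hiff := exists_eq_mul_expand_iff hs₁ hw
  rw [← hK] at hiff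
  rw [hiff, hasCommonFactor_iff_finrank_lt (r := (K - 1) % s₁ + 1) (ν := (K - 1) / s₁)
    (Nat.mod_lt _ hs₁) hm (formPart_mem_degreeLT K s₁ _)
    (fun i hi => sDecompLength_of_lt hK0 hs₁ hi) (fun i hi his => sDecompLength_of_le hK0 hi his)]
  generalize (K - 1) / s₁ = ν at hm ⊢
  -- The truncated subtractions are harmless because `m ≤ ν`.
  rw [show 2 * ν + 1 - (m + 1) = 2 * ν - m by omega, show 2 * ν + 2 - (m + 1) = 2 * ν + 1 - m by omega,
    show 2 * ν + 3 - 2 * (m + 1) = 2 * (ν - m) + 1 by omega,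
    show 2 * ν + 4 - 2 * (m + 1) = 2 * (ν - m) + 2 by omega]

theorem mem_zeroLocus_vanish_iff {K : ℕ} : ∀ (arch : List (ℕ × ℕ)), arch ≠ [] →
    (∀ layer ∈ arch, 0 < layer.1 ∧ 0 < layer.2) → K = filterSize arch → ∀ w : Fin K → ℂ,
    (w ∈ zeroLocus ℂ (vanish K arch) ↔ filterPoly w ∈ filterProducts ℂ arch)
  | [], hne, _, _, _ => absurd rfl hne
  | [(k, s)], _, _, hK, w => by
    obtain rfl : K = k := by simp [hK, filterSize]
    rw [vanish, zeroLocus_bot]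
    exact iff_of_true trivial ⟨_, filterPoly_mem_degreeLT w, 1, rfl, by simp⟩
  | [(k₁, s₁), (k₂, s₂)], _, hpos, hK, w =>
    mem_zeroLocus_vanish_pair_iff (hpos (k₁, s₁) (by simp)).1 (hpos (k₁, s₁) (by simp)).2
      (hpos (k₂, s₂) (by simp)).1 (by simpa [filterSize] using hK) w
  | (k₁, s₁) :: (k₂, s₂) :: layer :: rest, _, hpos, hK, w => by
    obtain ⟨hk₁, hs₁⟩ := hpos (k₁, s₁) (by simp)
    obtain ⟨hk₂, hs₂⟩ := hpos (k₂, s₂) (by simp)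
    have hrest : ∀ l ∈ layer :: rest, 0 < l.1 ∧ 0 < l.2 := fun l hl => hpos l (by simp [hl])
    simp only [filterSize.eq_2 k₁, filterSize.eq_2 k₂] at hK
    obtain ⟨m, rfl⟩ : ∃ m, k₂ = m + 1 := ⟨k₂ - 1, by omega⟩
    -- The second filter size in the recursive pair is the end-to-end size of all layers after the
    -- first.
    have hk : (K - k₁) / s₁ + 1 = m + 1 + s₂ * (filterSize (layer :: rest) - 1) := by
      rw [hK, Nat.add_sub_cancel_left, Nat.mul_div_cancel_left _ hs₁]
      omega
    rw [vanish, mem_zeroLocus_radical_add_iff, hk,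
      mem_filterProducts_cons_cons_iff hs₁ hk₂ hrest,
      mem_zeroLocus_vanish_iff _ (by simp) ?_ ?_ w,
      mem_zeroLocus_vanish_pair_iff hk₁ hs₁ (by omega) hK w]
    · intro l hl
      obtain rfl | hl := List.mem_cons.1 hl
      · exact ⟨by simp only; omega, Nat.mul_pos hs₁ hs₂⟩
      · exact hrest l hl
    · rw [hK, filterSize.eq_2 (k₁ + _), show m + 1 + s₂ * (filterSize (layer :: rest) - 1) - 1 =
        m + s₂ * (filterSize (layer :: rest) - 1) by omega, Nat.add_sub_cancel]
      ring
  termination_by arch => arch.length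

theorem isRadical_vanish {K : ℕ} (arch : List (ℕ × ℕ)) : (vanish K arch).IsRadical := by
  match arch with
  | [] => rw [vanish]; exact Ideal.isPrime_bot.isRadical
  | [_] => rw [vanish]; exact Ideal.isPrime_bot.isRadical
  | [_, _] => rw [vanish]; exact Ideal.radical_isRadical _
  | _ :: _ :: _ :: _ => rw [vanish]; exact Ideal.radical_isRadical _

end Vanishing

theorem theorem3p1 (arch : List (ℕ × ℕ)) (hne : arch ≠ [])
    (hpos : ∀ layer ∈ arch, 0 < layer.1 ∧ 0 < layer.2) (d : ℕ) (hd : 0 < d) :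
    vanish (filterSize arch) arch =
      MvPolynomial.vanishingIdeal ℂ (complexNeurovariety arch d) := by
  have h : complexNeurovariety arch d = MvPolynomial.zeroLocus ℂ (vanish (filterSize arch) arch) :=
    Set.ext fun w => (mem_complexNeurovariety_iff hne hpos hd w).trans
      (mem_zeroLocus_vanish_iff arch hne hpos rfl w).symm
  rw [h, MvPolynomial.vanishingIdeal_zeroLocus_eq_radical, (isRadical_vanish arch).radical]
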